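/- Let $\mathbb V=\mathbb R^n$ or $\mathbb V=\mathbb C^n$, let $A_1,\dots,A_m$ be symmetric (respectively Hermitian) $n\times n$ matrices, $v_1,\dots,v_m\in\mathbb V$ and $f^0\in\mathbb R^m$, and let $f:\mathbb V\to\mathbb R^m$ be the quadratic map $$f_i(x)=x^*A_ix-v_i^*x-x^*v_i+f^0_i,\qquad i=1,\dots,m.$$ For $c\in\mathbb R^m$ write $c\cdot A=\sum_i c_iA_i$ and $c\cdot(v-Ax_0)=\sum_i c_i(v_i-A_ix_0)$. For a positive definite (symmetric, respectively Hermitian) matrix $A_+$ put $|x|_+^2=x^*A_+x$, and let $\lambda^+_{\min}(M)$ be the smallest $\lambda\in\mathbb R$ such that $(M-\lambda A_+)x=0$ for some $x\ne0$. For $x_0\in\mathbb V$ define $$\varepsilon_{\max}^2(x_0,A_+)=\lim_{\epsilon\to0^+}\ \min_{c\in\mathcal C}\Big|\big(c\cdot A-\lambda^+_{\min}(c\cdot A)A_++\epsilon I\big)^{-1}\,c\cdot(v-Ax_0)\Big|_+^2,\qquad \mathcal C=\{c\in\mathbb R^m:\ |c|^2=1,\ \lambda^+_{\min}(c\cdot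 A)\le0\}.$$ If $\varepsilon_{\max}(x_0,A_+)=\infty$ for some point $x_0\in\mathbb V$ and some positive definite $A_+$, then the full image $\{f(x):x\in\mathbb V\}\subseteq\mathbb R^m$ is convex. -/

import Mathlib

open scoped ComplexOrder Matrix Topology ENNReal

noncomputable section

namespace QuadImage

variable {𝕜 : Type*} [RCLike 𝕜] {n m : ℕ}

/-- The quadratic map `f_i(x) = x* A_i x - v_i* x - x* v_i + f⁰_i` from `𝕜ⁿ` to `ℝᵐ`.
The expression inside `RCLike.re` is real when `A_i` is Hermitian. -/
def quadMap (A : Fin m → Matrix (Fin n) (Fin n) 𝕜) (v : Fin m → Fin n → 𝕜) (f₀ : Fin m → ℝ)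
    (x : Fin n → 𝕜) : Fin m → ℝ :=
  fun i => RCLike.re (star x ⬝ᵥ (A i *ᵥ x) - star (v i) ⬝ᵥ x - star x ⬝ᵥ v i) + f₀ i

/-- The combination `c · A = ∑ c_i A_i`. -/
def combMat (c : Fin m → ℝ) (A : Fin m → Matrix (Fin n) (Fin n) 𝕜) : Matrix (Fin n) (Fin n) 𝕜 :=
  ∑ i, c i • A i

/-- The vector `c · (v - A x₀) = ∑ c_i (v_i - A_i x₀)`. -/
def combVec (c : Fin m → ℝ) (A : Fin m → Matrix (Fin n) (Fin n) 𝕜) (v : Fin m → Fin n → 𝕜)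
    (x₀ : Fin n → 𝕜) : Fin n → 𝕜 :=
  ∑ i, c i • (v i - A i *ᵥ x₀)

/-- `|x|₊² = x* A₊ x`. -/
def plusNormSq (Aplus : Matrix (Fin n) (Fin n) 𝕜) (x : Fin n → 𝕜) : ℝ :=
  RCLike.re (star x ⬝ᵥ (Aplus *ᵥ x))

/-- The generalized eigenvalues of `M` with respect to `A₊` (all of them are real when `M` is
Hermitian and `A₊` is positive definite). -/
def genEigenvalues (Aplus M : Matrix (Fin n) (Fin n) 𝕜) : Set ℝ :=
  {l : ℝ | ∃ x : Fin n → 𝕜, x ≠ 0 ∧ (M - l • Aplus) *ᵥ x = 0}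

/-- The smallest generalized eigenvalue `λ⁺_min(M)`. For `n ≥ 1`, Hermitian `M` and `A₊ ≻ 0`
the set of generalized eigenvalues is finite and nonempty, so the infimum is a minimum. -/
def lamMin (Aplus M : Matrix (Fin n) (Fin n) 𝕜) : ℝ :=
  sInf (genEigenvalues Aplus M)

/-- The set `𝒞` of unit vectors `c ∈ ℝᵐ` with `λ⁺_min(c · A) ≤ 0`. -/
def admissible (A : Fin m → Matrix (Fin n) (Fin n) 𝕜) (Aplus : Matrix (Fin n) (Fin n) 𝕜) :
    Set (Fin m → ℝ) :=
  {c | c ⬝ᵥ c = 1 ∧ lamMin Aplus (combMat c A) ≤ 0}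

/-- `|(c·A - λ⁺_min(c·A) A₊ + ε)⁻¹ c·(v - A x₀)|₊²`, where `ε` stands for `ε` times the identity.
For `ε > 0` the inverted matrix is positive definite, hence invertible. -/
def resolventNormSq (A : Fin m → Matrix (Fin n) (Fin n) 𝕜) (v : Fin m → Fin n → 𝕜)
    (x₀ : Fin n → 𝕜) (Aplus : Matrix (Fin n) (Fin n) 𝕜) (ε : ℝ) (c : Fin m → ℝ) : ℝ :=
  plusNormSq Aplus
    ((combMat c A - lamMin Aplus (combMat c A) • Aplus +
        ε • (1 : Matrix (Fin n) (Fin n) 𝕜))⁻¹ *ᵥ combVec c A v x₀)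

/-- The minimum of `resolventNormSq` over `c ∈ 𝒞`, in `[0, ∞]`. -/
def minResolventNormSq (A : Fin m → Matrix (Fin n) (Fin n) 𝕜) (v : Fin m → Fin n → 𝕜)
    (x₀ : Fin n → 𝕜) (Aplus : Matrix (Fin n) (Fin n) 𝕜) (ε : ℝ) : ℝ≥0∞ :=
  ⨅ c ∈ admissible A Aplus, ENNReal.ofReal (resolventNormSq A v x₀ Aplus ε c)

/-- `ε²_max(x₀, A₊)`, the limit of the minimum over `𝒞` as `ε → 0⁺`, exists in `[0, ∞]` and
equals `L`. -/
def HasEpsMaxSq (A : Fin m → Matrix (Fin n) (Fin n) 𝕜) (v : Fin m → Fin n → 𝕜)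
    (x₀ : Fin n → 𝕜) (Aplus : Matrix (Fin n) (Fin n) 𝕜) (L : ℝ≥0∞) : Prop :=
  Filter.Tendsto (minResolventNormSq A v x₀ Aplus) (𝓝[>] (0 : ℝ)) (𝓝 L)

end QuadImage

end

/-!
Given `x₁` and `x₂`, take a closed ball `B` of the norm `|·|₊` such that `x₀ + B` contains both, and
let `p` be a convex combination of `f x₁` and `f x₂`. Shrink the ball: put `F t y = f (x₀ + t y)`.
The convex hull of `F t '' B` contains `p` for `t = 1` and is the single point `f x₀` for `t = 0`.
Hence either `p = f x₀` or, by connectedness, there is a `t` for which `p` lies in the hull of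
`F t '' B` and on one of its supporting hyperplanes. If every supporting hyperplane touches
`F t '' B` in one point only, that point must be `p`.

So it remains to see that `c · f` has a unique minimizer on each ball around `x₀`. Up to a constant,
`c · f (x₀ + y) = y* M y - b* y - y* b` with `M = c · A` and `b = c · (v - A x₀)`. This is strictly
convex when `λ = λ⁺_min(M)` is positive. Otherwise `N = M - λ A₊` is positive semidefinite and
`ε_max = ∞` says that `b` is not in the range of `N`, since `(N + ε)⁻¹ b` stays bounded as `ε → 0`
when it is. Then there is `z` in the kernel of `N` with `Re z* b > 0`, and
`h y = y* N y - b* y - y* b` decreases strictly along `z`. Following `z` out to the sphere shows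
that minimizers of `c · f` lie on the sphere, where `c · f` and `h` differ by a constant. If there
were two of them, then from their midpoint, where `h` is no larger, following `z` would lead to a
better point of the sphere.
-/

namespace QuadImage

section SupportPoints

variable {E : Type*} [NormedAddCommGroup E] [InnerProductSpace ℝ E]

/-- Every supporting hyperplane touches `K` in at most one point: for each unit vector `c`, the
linear function `⟪c, ·⟫` has at most one minimizer on `K`. For compact `K` in a finite-dimensional
space this says that the convex hull of `K` is strictly convex. -/
def HasUniqueSupportPoints (K : Set E) : Prop :=
  ∀ c : E, ‖c‖ = 1 → {z ∈ K | IsMinOn (inner ℝ c) K z}.Subsingleton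

theorem exists_inner_le_of_mem_convexHull {K : Set E} {p : E} (hp : p ∈ convexHull ℝ K) (d : E) :
    ∃ z ∈ K, inner ℝ d z ≤ inner ℝ d p :=
  ((innerₛₗ ℝ d).concaveOn convex_univ).exists_le_of_mem_convexHull (Set.subset_univ K) hp

theorem forall_exists_inner_le_or_exists_norm_eq_one {K : Set E} (hK : K.Nonempty) (p : E) :
    (∀ d, ∃ z ∈ K, inner ℝ d z ≤ inner ℝ d p) ∨
      ∃ c : E, ‖c‖ = 1 ∧ ∀ z ∈ K, inner ℝ c p ≤ inner ℝ c z := by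
  refine or_iff_not_imp_left.2 fun h => ?_
  obtain ⟨d, hd⟩ : ∃ d, ∀ z ∈ K, inner ℝ d p < inner ℝ d z := by simpa using h
  obtain ⟨z₀, hz₀⟩ := hK
  have d_ne : d ≠ 0 := by
    rintro rfl
    simpa using hd z₀ hz₀
  refine ⟨‖d‖⁻¹ • d, by simp [norm_smul, d_ne], fun z hz => ?_⟩
  simp only [real_inner_smul_left]
  gcongr
  exact (hd z hz).le

theorem exists_mem_inner_le_and_inner_le {K : Set E} (hK : IsCompact K) {c p : E}
    (hcp : ∀ z ∈ K, inner ℝ c p ≤ inner ℝ c z) (hp : ∀ d, ∃ z ∈ K, inner ℝ d z ≤ inner ℝ d p)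
    (e : E) : ∃ z ∈ K, inner ℝ c z ≤ inner ℝ c p ∧ inner ℝ e z ≤ inner ℝ e p := by
  -- A point below `p` in all the directions `k c + e` is below `p` in the directions `c` and `e`.
  let gap : ℕ → E → ℝ := fun k z =>
    k * (inner ℝ c z - inner ℝ c p) + (inner ℝ e z - inner ℝ e p)
  let S : ℕ → Set E := fun k => {z ∈ K | gap k z ≤ 0}
  have gap_continuous : ∀ k, Continuous (gap k) := fun k => by fun_prop
  have S_closed : ∀ k, IsClosed (S k) := fun k =>
    hK.isClosed.inter (isClosed_le (gap_continuous k) continuous_const)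
  have S_succ : ∀ k, S (k + 1) ⊆ S k := by
    rintro k z ⟨hz, hle⟩
    refine ⟨hz, ?_⟩
    simp only [gap, Nat.cast_add, Nat.cast_one] at hle ⊢
    linarith [hcp z hz]
  have S_nonempty : ∀ k, (S k).Nonempty := by
    intro k
    obtain ⟨z, hz, hle⟩ := hp ((k : ℝ) • c + e)
    simp only [inner_add_left, real_inner_smul_left] at hle
    exact ⟨z, hz, by linarith⟩
  obtain ⟨z, hzS⟩ := IsCompact.nonempty_iInter_of_sequence_nonempty_isCompact_isClosed S S_succ
    S_nonempty (hK.of_isClosed_subset (S_closed 0) (Set.sep_subset _ _)) S_closed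
  rw [Set.mem_iInter] at hzS
  refine ⟨z, (hzS 0).1, ?_, by simpa [gap] using (hzS 0).2⟩
  by_contra! hlt
  obtain ⟨k, hk⟩ := exists_nat_gt
    (-(inner ℝ e z - inner ℝ e p) / (inner ℝ c z - inner ℝ c p))
  rw [div_lt_iff₀ (sub_pos.2 hlt)] at hk
  linarith [(hzS k).2]

theorem mem_of_subsingleton_minimizers {K : Set E} (hK : IsCompact K) {c p : E}
    (hmin : {z ∈ K | IsMinOn (inner ℝ c) K z}.Subsingleton)
    (hcp : ∀ z ∈ K, inner ℝ c p ≤ inner ℝ c z) (hp : ∀ d, ∃ z ∈ K, inner ℝ d z ≤ inner ℝ d p) :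
    p ∈ K := by
  have mem_minimizers : ∀ z ∈ K, inner ℝ c z ≤ inner ℝ c p →
      z ∈ {z ∈ K | IsMinOn (inner ℝ c) K z} :=
    fun z hz hzp => ⟨hz, fun z' hz' => hzp.trans (hcp z' hz')⟩
  obtain ⟨z₀, hz₀, hcz₀⟩ := hp c
  obtain ⟨z, hz, hcz, hez⟩ := exists_mem_inner_le_and_inner_le hK hcp hp (z₀ - p)
  obtain rfl : z = z₀ := hmin (mem_minimizers z hz hcz) (mem_minimizers z₀ hz₀ hcz₀)
  have hself : inner ℝ (z - p) (z - p) ≤ 0 := by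
    rw [inner_sub_right]
    exact sub_nonpos.2 hez
  obtain rfl : z = p := sub_eq_zero.1 (real_inner_self_nonpos.1 hself)
  exact hz

theorem isClosed_setOf_exists_mem {X Y : Type*} [TopologicalSpace X] [TopologicalSpace Y]
    {S : Set Y} (hS : IsCompact S) {C : Set (X × Y)} (hC : IsClosed C) :
    IsClosed {x | ∃ y ∈ S, (x, y) ∈ C} := by
  have : CompactSpace S := isCompact_iff_compactSpace.1 hS
  have himage : {x | ∃ y ∈ S, (x, y) ∈ C} =
      Prod.fst '' {q : X × S | (q.1, (q.2 : Y)) ∈ C} := by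
    ext x
    simp
  rw [himage]
  exact isClosedMap_fst_of_compactSpace _ (hC.preimage (by fun_prop))

theorem exists_mem_image_of_mem_convexHull [FiniteDimensional ℝ E] {T Y : Type*}
    [TopologicalSpace T] [PreconnectedSpace T] [TopologicalSpace Y] {B : Set Y} (hB : IsCompact B)
    {F : T → Y → E} (hF : Continuous ↿F) {t₀ : T} (hconst : (F t₀ '' B).Subsingleton)
    (huniq : ∀ t ≠ t₀, HasUniqueSupportPoints (F t '' B)) {t₁ : T} {p : E}
    (hp : p ∈ convexHull ℝ (F t₁ '' B)) : ∃ t, p ∈ F t '' B := by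
  let inHull : Set T := {t | ∀ d, ∃ y ∈ B, inner ℝ d (F t y) ≤ inner ℝ d p}
  let supported : Set T :=
    {t | ∃ c ∈ Metric.sphere (0 : E) 1, ∀ y ∈ B, inner ℝ c p ≤ inner ℝ c (F t y)}
  have compact_image : ∀ t, IsCompact (F t '' B) := fun t =>
    hB.image (hF.comp (Continuous.prodMk_right t))
  have mem_image : ∀ t ∈ inHull, ∀ c, (∀ y ∈ B, inner ℝ c p ≤ inner ℝ c (F t y)) →
      {z ∈ F t '' B | IsMinOn (inner ℝ c) (F t '' B) z}.Subsingleton → p ∈ F t '' B :=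
    fun t ht c hc hmin => mem_of_subsingleton_minimizers (compact_image t) hmin
      (Set.forall_mem_image.2 hc) fun d => Set.exists_mem_image.2 (ht d)
  have hF' : Continuous fun q : T × Y => F q.1 q.2 := hF
  have inHull_closed : IsClosed inHull := by
    simp only [inHull, Set.ofPred_forall]
    exact isClosed_iInter fun d => isClosed_setOf_exists_mem hB
      (C := {q | inner ℝ d (F q.1 q.2) ≤ inner ℝ d p})
      (isClosed_le (by fun_prop) continuous_const)
  have supported_closed : IsClosed supported := by
    refine isClosed_setOf_exists_mem (isCompact_sphere 0 1)
      (C := {q : T × E | ∀ y ∈ B, inner ℝ q.2 p ≤ inner ℝ q.2 (F q.1 y)}) ?_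
    simp only [Set.ofPred_forall]
    exact isClosed_biInter fun y _ => isClosed_le (by fun_prop)
      (continuous_snd.inner (hF.comp (continuous_fst.prodMk continuous_const)))
  have t₁_mem : t₁ ∈ inHull := fun d =>
    Set.exists_mem_image.1 (exists_inner_le_of_mem_convexHull hp d)
  have cover : Set.univ ⊆ inHull ∪ supported := by
    obtain ⟨y₀, hy₀, -⟩ := t₁_mem 0
    rintro t -
    simpa [inHull, supported] using
      forall_exists_inner_le_or_exists_norm_eq_one ⟨F t y₀, Set.mem_image_of_mem (F t) hy₀⟩ p
  rcases supported.eq_empty_or_nonempty with hempty | hnonempty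
  · have ht₀ : t₀ ∈ inHull := by simpa [hempty] using cover (Set.mem_univ t₀)
    exact ⟨t₀, mem_image t₀ ht₀ 0 (by simp) (hconst.anti (Set.sep_subset _ _))⟩
  · obtain ⟨t, -, ht, c, hc, hcp⟩ := isPreconnected_closed_iff.1 isPreconnected_univ inHull
      supported inHull_closed supported_closed cover ⟨t₁, trivial, t₁_mem⟩ (by simpa)
    refine ⟨t, mem_image t ht c hcp ?_⟩
    rcases eq_or_ne t t₀ with rfl | hne
    · exact hconst.anti (Set.sep_subset _ _)
    · exact huniq t hne c (mem_sphere_zero_iff_norm.1 hc)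

end SupportPoints

section HermitianForms

variable {𝕜 : Type*} [RCLike 𝕜] {n : ℕ} {M P : Matrix (Fin n) (Fin n) 𝕜}

theorem exists_ne_zero_forall_div_mul_le {V : Type*} [NormedAddCommGroup V] [NormedSpace ℝ V]
    [ProperSpace V] [Nontrivial V] {f g : V → ℝ} (hf : Continuous f) (hg : Continuous g)
    (f_smul : ∀ (t : ℝ) x, f (t • x) = t ^ 2 * f x)
    (g_smul : ∀ (t : ℝ) x, g (t • x) = t ^ 2 * g x) (g_pos : ∀ x ≠ 0, 0 < g x) :
    ∃ x ≠ 0, ∀ y, f x / g x * g y ≤ f y := by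
  have ne_zero : ∀ x ∈ Metric.sphere (0 : V) 1, x ≠ 0 := fun x hx =>
    Metric.ne_of_mem_sphere hx one_ne_zero
  obtain ⟨x, hx, hmin⟩ := (isCompact_sphere (0 : V) 1).exists_isMinOn
    (NormedSpace.sphere_nonempty.2 zero_le_one)
    (hf.continuousOn.div hg.continuousOn fun x hx => (g_pos x (ne_zero x hx)).ne')
  refine ⟨x, ne_zero x hx, fun y => ?_⟩
  rcases eq_or_ne y 0 with rfl | hy
  · have f_zero : f 0 = 0 := by simpa using f_smul 0 0
    have g_zero : g 0 = 0 := by simpa using g_smul 0 0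
    rw [f_zero, g_zero, mul_zero]
  have hle : f x / g x ≤ f (‖y‖⁻¹ • y) / g (‖y‖⁻¹ • y) :=
    hmin (by simp [norm_smul, hy])
  rw [f_smul, g_smul, mul_div_mul_left _ _ (by simpa using hy)] at hle
  exact (le_div_iff₀ (g_pos y hy)).1 hle

theorem re_star_dotProduct_comm (x y : Fin n → 𝕜) :
    RCLike.re (star x ⬝ᵥ y) = RCLike.re (star y ⬝ᵥ x) := by
  rw [← RCLike.conj_re, ← RCLike.star_def, Matrix.star_dotProduct, star_star]

theorem re_star_dotProduct_mulVec_comm (hM : M.IsHermitian) (x y : Fin n → 𝕜) :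
    RCLike.re (star x ⬝ᵥ (M *ᵥ y)) = RCLike.re (star y ⬝ᵥ (M *ᵥ x)) := by
  rw [re_star_dotProduct_comm, Matrix.star_mulVec, hM.eq, Matrix.dotProduct_mulVec]

theorem continuous_plusNormSq (M : Matrix (Fin n) (Fin n) 𝕜) : Continuous (plusNormSq M) := by
  unfold plusNormSq
  fun_prop

theorem plusNormSq_smul (M : Matrix (Fin n) (Fin n) 𝕜) (t : ℝ) (x : Fin n → 𝕜) :
    plusNormSq M (t • x) = t ^ 2 * plusNormSq M x := by
  simp only [plusNormSq, star_smul, Matrix.mulVec_smul, smul_dotProduct, dotProduct_smul,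
    RCLike.smul_re, star_trivial]
  ring

theorem plusNormSq_add (hM : M.IsHermitian) (x y : Fin n → 𝕜) :
    plusNormSq M (x + y) =
      plusNormSq M x + 2 * RCLike.re (star x ⬝ᵥ (M *ᵥ y)) + plusNormSq M y := by
  simp only [plusNormSq, star_add, Matrix.mulVec_add, add_dotProduct, dotProduct_add, map_add,
    re_star_dotProduct_mulVec_comm hM y x]
  ring

theorem plusNormSq_sub_smul (M P : Matrix (Fin n) (Fin n) 𝕜) (l : ℝ) (x : Fin n → 𝕜) :
    plusNormSq (M - l • P) x = plusNormSq M x - l * plusNormSq P x := by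
  simp only [plusNormSq, Matrix.sub_mulVec, Matrix.smul_mulVec, dotProduct_sub, dotProduct_smul,
    map_sub, RCLike.smul_re]

theorem plusNormSq_nonneg (hM : M.PosSemidef) (x : Fin n → 𝕜) : 0 ≤ plusNormSq M x :=
  hM.re_dotProduct_nonneg x

theorem plusNormSq_pos (hP : P.PosDef) {x : Fin n → 𝕜} (hx : x ≠ 0) : 0 < plusNormSq P x :=
  hP.re_dotProduct_pos hx

theorem posSemidef_of_plusNormSq_nonneg (hM : M.IsHermitian) (h : ∀ x, 0 ≤ plusNormSq M x) :
    M.PosSemidef :=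
  .of_dotProduct_mulVec_nonneg hM fun x =>
    RCLike.nonneg_iff.2 ⟨h x, hM.im_star_dotProduct_mulVec_self x⟩

theorem mulVec_eq_zero_of_plusNormSq_eq_zero (hM : M.PosSemidef) {x : Fin n → 𝕜}
    (hx : plusNormSq M x = 0) : M *ᵥ x = 0 :=
  (hM.dotProduct_mulVec_zero_iff x).1
    (RCLike.ext (by simpa [plusNormSq] using hx)
      (by simpa using hM.1.im_star_dotProduct_mulVec_self x))

theorem isHermitian_sub_real_smul (hM : M.IsHermitian) (hP : P.IsHermitian) (l : ℝ) :
    (M - l • P).IsHermitian :=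
  hM.sub (hP.smul (.all l))

theorem exists_genEigenvalue_posSemidef_sub_smul [Nontrivial (Fin n → 𝕜)] (hM : M.IsHermitian)
    (hP : P.PosDef) : ∃ μ ∈ genEigenvalues P M, (M - μ • P).PosSemidef := by
  obtain ⟨x, hx, hle⟩ := exists_ne_zero_forall_div_mul_le (continuous_plusNormSq M)
    (continuous_plusNormSq P) (plusNormSq_smul M) (plusNormSq_smul P) fun x => plusNormSq_pos hP
  set μ := plusNormSq M x / plusNormSq P x with hμ
  have hN : (M - μ • P).PosSemidef :=
    posSemidef_of_plusNormSq_nonneg (isHermitian_sub_real_smul hM hP.1 μ) fun y => by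
      rw [plusNormSq_sub_smul]
      exact sub_nonneg.2 (hle y)
  refine ⟨μ, ⟨x, hx, mulVec_eq_zero_of_plusNormSq_eq_zero hN ?_⟩, hN⟩
  rw [plusNormSq_sub_smul, hμ, div_mul_cancel₀ _ (plusNormSq_pos hP hx).ne', sub_self]

theorem le_of_mem_genEigenvalues (hP : P.PosDef) {l μ : ℝ} (hμ : (M - μ • P).PosSemidef)
    (hl : l ∈ genEigenvalues P M) : μ ≤ l := by
  obtain ⟨x, hx, hlx⟩ := hl
  have form_l : plusNormSq (M - l • P) x = 0 := by simp [plusNormSq, hlx]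
  have form_μ : 0 ≤ plusNormSq (M - μ • P) x := plusNormSq_nonneg hμ x
  rw [plusNormSq_sub_smul] at form_l form_μ
  exact le_of_mul_le_mul_right (by linarith) (plusNormSq_pos hP hx)

theorem posSemidef_sub_lamMin_smul (hM : M.IsHermitian) (hP : P.PosDef) :
    (M - lamMin P M • P).PosSemidef := by
  rcases subsingleton_or_nontrivial (Fin n → 𝕜) with _ | _
  · refine posSemidef_of_plusNormSq_nonneg (isHermitian_sub_real_smul hM hP.1 _) fun x => ?_
    simp [plusNormSq, Subsingleton.elim x 0]
  · obtain ⟨μ, hμ, hN⟩ := exists_genEigenvalue_posSemidef_sub_smul hM hP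
    have hleast : IsLeast (genEigenvalues P M) μ :=
      ⟨hμ, fun l hl => le_of_mem_genEigenvalues hP hN hl⟩
    rwa [lamMin, hleast.csInf_eq]

theorem posDef_of_lamMin_pos (hM : M.IsHermitian) (hP : P.PosDef) (hpos : 0 < lamMin P M) :
    M.PosDef := by
  simpa using (hP.smul hpos).posSemidef_add (posSemidef_sub_lamMin_smul hM hP)

theorem exists_mulVec_eq_zero_of_notMem_range {ι : Type*} [Fintype ι] {N : Matrix ι ι 𝕜}
    (hN : N.IsHermitian) {b : ι → 𝕜} (hb : b ∉ Set.range N.mulVec) :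
    ∃ z, N *ᵥ z = 0 ∧ 0 < RCLike.re (star z ⬝ᵥ b) := by
  classical
  let T := Matrix.toEuclideanLin N
  have hT : T.IsSymmetric := Matrix.isSymmetric_toEuclideanLin_iff.2 hN
  have hbT : WithLp.toLp 2 b ∉ (LinearMap.ker T)ᗮ := by
    rw [← hT.orthogonal_range, Submodule.orthogonal_orthogonal]
    rintro ⟨w, hw⟩
    exact hb ⟨w.ofLp, congrArg WithLp.ofLp hw⟩
  obtain ⟨z, hz, hzb⟩ : ∃ z ∈ LinearMap.ker T, inner 𝕜 z (WithLp.toLp 2 b) ≠ 0 := by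
    simpa [Submodule.mem_orthogonal] using hbT
  have hNz : N *ᵥ z.ofLp = 0 := congrArg WithLp.ofLp (LinearMap.mem_ker.1 hz)
  rw [EuclideanSpace.inner_eq_star_dotProduct, dotProduct_comm] at hzb
  refine ⟨(star z.ofLp ⬝ᵥ b) • z.ofLp, by rw [Matrix.mulVec_smul, hNz, smul_zero], ?_⟩
  rw [star_smul, smul_dotProduct, smul_eq_mul, RCLike.star_def, RCLike.conj_mul]
  norm_cast
  have := norm_pos_iff.2 hzb
  positivity

end HermitianForms

section Minimizers

variable {𝕜 : Type*} [RCLike 𝕜] {n : ℕ} {M N P : Matrix (Fin n) (Fin n) 𝕜} {b : Fin n → 𝕜} {ρ : ℝ}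

/-- The closed ball of the norm `|·|₊` around the origin, with `ρ` the square of the radius. -/
def plusBall (P : Matrix (Fin n) (Fin n) 𝕜) (ρ : ℝ) : Set (Fin n → 𝕜) :=
  {y | plusNormSq P y ≤ ρ}

/-- The real quadratic function `y* M y - b* y - y* b`; up to a constant, `c · f(x₀ + y)` has this
form with `M = c · A` and `b = c · (v - A x₀)`. -/
def quadObjective (M : Matrix (Fin n) (Fin n) 𝕜) (b y : Fin n → 𝕜) : ℝ :=
  plusNormSq M y - 2 * RCLike.re (star y ⬝ᵥ b)

theorem isCompact_plusBall (hP : P.PosDef) (ρ : ℝ) : IsCompact (plusBall P ρ) := by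
  refine Metric.isCompact_of_isClosed_isBounded
    (isClosed_le (continuous_plusNormSq P) continuous_const) ?_
  rcases subsingleton_or_nontrivial (Fin n → 𝕜) with _ | _
  · exact (Set.toFinite _).isBounded
  obtain ⟨x, hx, hle⟩ := exists_ne_zero_forall_div_mul_le (continuous_plusNormSq P)
    (g := fun y => ‖y‖ ^ 2) (by fun_prop) (plusNormSq_smul P)
    (fun t y => by rw [norm_smul, mul_pow, Real.norm_eq_abs, sq_abs])
    (fun y hy => by positivity)
  set μ := plusNormSq P x / ‖x‖ ^ 2
  have μ_pos : 0 < μ := div_pos (plusNormSq_pos hP hx) (by positivity)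
  refine isBounded_iff_forall_norm_le.2 ⟨√(ρ / μ), fun y hy => Real.le_sqrt_of_sq_le ?_⟩
  rw [le_div_iff₀ μ_pos, mul_comm]
  exact (hle y).trans hy

theorem image_smul_plusBall (P : Matrix (Fin n) (Fin n) 𝕜) (ρ : ℝ) {t : ℝ} (ht : t ≠ 0) :
    (t • ·) '' plusBall P ρ = plusBall P (t ^ 2 * ρ) := by
  rw [Set.image_smul]
  ext y
  rw [Set.mem_smul_set_iff_inv_smul_mem₀ ht]
  simp only [plusBall, Set.mem_ofPred_eq, plusNormSq_smul]
  rw [inv_pow, inv_mul_le_iff₀ (by positivity)]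

theorem quadObjective_sub_smul (M P : Matrix (Fin n) (Fin n) 𝕜) (l : ℝ) (b y : Fin n → 𝕜) :
    quadObjective (M - l • P) b y = quadObjective M b y - l * plusNormSq P y := by
  rw [quadObjective, quadObjective, plusNormSq_sub_smul]
  ring

theorem quadObjective_convex_combination (hM : M.IsHermitian) (b x y : Fin n → 𝕜) {s t : ℝ}
    (hst : s + t = 1) :
    quadObjective M b (s • x + t • y) =
      s * quadObjective M b x + t * quadObjective M b y - s * t * plusNormSq M (x - y) := by
  obtain rfl : t = 1 - s := by linarith
  simp only [quadObjective, plusNormSq, star_add, star_sub, star_smul, star_trivial,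
    Matrix.mulVec_add, Matrix.mulVec_sub, Matrix.mulVec_smul, add_dotProduct, sub_dotProduct,
    dotProduct_add, dotProduct_sub, smul_dotProduct, dotProduct_smul, map_add, map_sub,
    RCLike.smul_re, re_star_dotProduct_mulVec_comm hM y x]
  ring

theorem convexOn_quadObjective (hM : M.PosSemidef) (b : Fin n → 𝕜) :
    ConvexOn ℝ Set.univ (quadObjective M b) := by
  refine ⟨convex_univ, fun x _ y _ s t hs ht hst => ?_⟩
  rw [quadObjective_convex_combination hM.1 b x y hst, smul_eq_mul, smul_eq_mul]
  exact sub_le_self _ (mul_nonneg (mul_nonneg hs ht) (plusNormSq_nonneg hM _))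

theorem strictConvexOn_quadObjective (hM : M.PosDef) (b : Fin n → 𝕜) :
    StrictConvexOn ℝ Set.univ (quadObjective M b) := by
  refine ⟨convex_univ, fun x _ y _ hxy s t hs ht hst => ?_⟩
  rw [quadObjective_convex_combination hM.1 b x y hst, smul_eq_mul, smul_eq_mul]
  exact sub_lt_self _ (mul_pos (mul_pos hs ht) (plusNormSq_pos hM (sub_ne_zero.2 hxy)))

theorem strictConvexOn_plusNormSq (hP : P.PosDef) : StrictConvexOn ℝ Set.univ (plusNormSq P) := by
  have h : plusNormSq P = quadObjective P 0 := by
    ext y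
    simp [quadObjective]
  exact h ▸ strictConvexOn_quadObjective hP 0

theorem convex_plusBall (hP : P.PosDef) (ρ : ℝ) : Convex ℝ (plusBall P ρ) := by
  simpa [plusBall] using (strictConvexOn_plusNormSq hP).convexOn.convex_le ρ

theorem exists_pos_plusNormSq_add_smul_eq (hP : P.PosDef) {w z : Fin n → 𝕜} (hz : z ≠ 0)
    (hw : plusNormSq P w < ρ) : ∃ t : ℝ, 0 < t ∧ plusNormSq P (w + t • z) = ρ := by
  have norm_ray : ∀ t : ℝ, plusNormSq P (w + t • z) =
      plusNormSq P w + t * (2 * RCLike.re (star w ⬝ᵥ (P *ᵥ z)) + t * plusNormSq P z) := by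
    intro t
    rw [plusNormSq_add hP.1, plusNormSq_smul, Matrix.mulVec_smul, dotProduct_smul, RCLike.smul_re]
    ring
  have norm_tendsto : Filter.Tendsto (fun t : ℝ => plusNormSq P (w + t • z)) .atTop .atTop := by
    simp only [norm_ray]
    exact Filter.tendsto_atTop_add_const_left _ _ (Filter.tendsto_id.atTop_mul_atTop₀
      (Filter.tendsto_atTop_add_const_left _ _
        (Filter.tendsto_id.atTop_mul_const (plusNormSq_pos hP hz))))
  obtain ⟨t, ht, htρ⟩ := isPreconnected_Ici.intermediate_value_Ici (Set.self_mem_Ici (a := (0 : ℝ)))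
    (Filter.le_principal_iff.2 (Filter.Ici_mem_atTop 0))
    ((continuous_plusNormSq P).comp (by fun_prop : Continuous fun t : ℝ => w + t • z)).continuousOn
    norm_tendsto (show ρ ∈ Set.Ici _ by simpa using hw.le)
  have t_ne : t ≠ 0 := by
    rintro rfl
    simp [hw.ne] at htρ
  exact ⟨t, lt_of_le_of_ne ht t_ne.symm, htρ⟩

theorem exists_plusNormSq_eq_quadObjective_lt (hN : N.IsHermitian) (hP : P.PosDef)
    (hb : b ∉ Set.range N.mulVec) {w : Fin n → 𝕜} (hw : plusNormSq P w < ρ) :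
    ∃ w', plusNormSq P w' = ρ ∧ quadObjective N b w' < quadObjective N b w := by
  obtain ⟨z, hz, hzb⟩ := exists_mulVec_eq_zero_of_notMem_range hN hb
  have z_ne : z ≠ 0 := by
    rintro rfl
    simp at hzb
  obtain ⟨t, t_pos, ht⟩ := exists_pos_plusNormSq_add_smul_eq hP z_ne hw
  refine ⟨w + t • z, ht, ?_⟩
  have form_eq : plusNormSq N (w + t • z) = plusNormSq N w := by
    rw [plusNormSq_add hN, plusNormSq_smul, plusNormSq, plusNormSq, Matrix.mulVec_smul, hz]
    simp
  rw [quadObjective, quadObjective, form_eq, star_add, star_smul, star_trivial t,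
    add_dotProduct, smul_dotProduct, map_add, RCLike.smul_re]
  linarith [mul_pos t_pos hzb]

theorem plusNormSq_eq_of_isMinOn_quadObjective (hM : M.IsHermitian) (hP : P.PosDef) {l : ℝ}
    (hl : l ≤ 0) (hb : b ∉ Set.range (M - l • P).mulVec) {y : Fin n → 𝕜} (hy : y ∈ plusBall P ρ)
    (hmin : IsMinOn (quadObjective M b) (plusBall P ρ) y) : plusNormSq P y = ρ := by
  by_contra hne
  obtain ⟨w, hw, hlt⟩ := exists_plusNormSq_eq_quadObjective_lt
    (isHermitian_sub_real_smul hM hP.1 l) hP hb (lt_of_le_of_ne hy hne)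
  have hle : quadObjective M b y ≤ quadObjective M b w := hmin hw.le
  have hlρ : l * ρ ≤ l * plusNormSq P y := mul_le_mul_of_nonpos_left hy hl
  rw [quadObjective_sub_smul, quadObjective_sub_smul, hw] at hlt
  linarith

theorem eq_of_isMinOn_quadObjective_of_notMem_range (hM : M.IsHermitian) (hP : P.PosDef) {l : ℝ}
    (hl : l ≤ 0) (hN : (M - l • P).PosSemidef) (hb : b ∉ Set.range (M - l • P).mulVec)
    {y₁ y₂ : Fin n → 𝕜} (hy₁ : y₁ ∈ plusBall P ρ) (hy₂ : y₂ ∈ plusBall P ρ)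
    (h₁ : IsMinOn (quadObjective M b) (plusBall P ρ) y₁)
    (h₂ : IsMinOn (quadObjective M b) (plusBall P ρ) y₂) : y₁ = y₂ := by
  by_contra hne
  have norm_y₁ := plusNormSq_eq_of_isMinOn_quadObjective hM hP hl hb hy₁ h₁
  have norm_y₂ := plusNormSq_eq_of_isMinOn_quadObjective hM hP hl hb hy₂ h₂
  have half_pos : (0 : ℝ) < 1 / 2 := by norm_num
  set w := (1 / 2 : ℝ) • y₁ + (1 / 2 : ℝ) • y₂
  have norm_w : plusNormSq P w < ρ :=
    calc plusNormSq P w < 1 / 2 * plusNormSq P y₁ + 1 / 2 * plusNormSq P y₂ :=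
          (strictConvexOn_plusNormSq hP).2 (Set.mem_univ y₁) (Set.mem_univ y₂) hne half_pos half_pos
            (by norm_num)
      _ = ρ := by rw [norm_y₁, norm_y₂]; ring
  have objective_w : quadObjective (M - l • P) b w ≤
      1 / 2 * quadObjective (M - l • P) b y₁ + 1 / 2 * quadObjective (M - l • P) b y₂ :=
    (convexOn_quadObjective hN b).2 (Set.mem_univ y₁) (Set.mem_univ y₂) half_pos.le half_pos.le
      (by norm_num)
  obtain ⟨w', norm_w', hlt⟩ := exists_plusNormSq_eq_quadObjective_lt hN.1 hP hb norm_w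
  have hle₁ : quadObjective M b y₁ ≤ quadObjective M b w' := h₁ norm_w'.le
  have hle₂ : quadObjective M b y₂ ≤ quadObjective M b w' := h₂ norm_w'.le
  replace hlt := hlt.trans_le objective_w
  simp only [quadObjective_sub_smul, norm_y₁, norm_y₂, norm_w'] at hlt
  linarith

theorem eq_of_isMinOn_quadObjective (hM : M.IsHermitian) (hP : P.PosDef)
    (hb : lamMin P M ≤ 0 → b ∉ Set.range (M - lamMin P M • P).mulVec)
    {y₁ y₂ : Fin n → 𝕜} (hy₁ : y₁ ∈ plusBall P ρ) (hy₂ : y₂ ∈ plusBall P ρ)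
    (h₁ : IsMinOn (quadObjective M b) (plusBall P ρ) y₁)
    (h₂ : IsMinOn (quadObjective M b) (plusBall P ρ) y₂) : y₁ = y₂ := by
  rcases lt_or_ge 0 (lamMin P M) with hlam | hlam
  · have hM' : M.PosDef := posDef_of_lamMin_pos hM hP hlam
    exact ((strictConvexOn_quadObjective hM' b).subset (Set.subset_univ _)
      (convex_plusBall hP ρ)).eq_of_isMinOn h₁ h₂ hy₁ hy₂
  · exact eq_of_isMinOn_quadObjective_of_notMem_range hM hP hlam
      (posSemidef_sub_lamMin_smul hM hP) (hb hlam) hy₁ hy₂ h₁ h₂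

end Minimizers

section Resolvent

variable {𝕜 : Type*} [RCLike 𝕜] {n m : ℕ}

theorem plusNormSq_one_resolvent_mulVec_le {N : Matrix (Fin n) (Fin n) 𝕜} (hN : N.PosSemidef)
    {ε : ℝ} (hε : 0 < ε) (w : Fin n → 𝕜) :
    plusNormSq 1 ((N + ε • (1 : Matrix (Fin n) (Fin n) 𝕜))⁻¹ *ᵥ (N *ᵥ w)) ≤ plusNormSq 1 w := by
  have posDef_add : (N + ε • (1 : Matrix (Fin n) (Fin n) 𝕜)).PosDef :=
    Matrix.PosDef.posSemidef_add hN (Matrix.PosDef.one.smul hε)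
  set u := (N + ε • (1 : Matrix (Fin n) (Fin n) 𝕜))⁻¹ *ᵥ (N *ᵥ w) with hu
  have hNu : N *ᵥ u + ε • u = N *ᵥ w := by
    have mulVec_u : (N + ε • (1 : Matrix (Fin n) (Fin n) 𝕜)) *ᵥ u = N *ᵥ w := by
      rw [hu, Matrix.mulVec_mulVec,
        Matrix.mul_nonsing_inv _ ((Matrix.isUnit_iff_isUnit_det _).1 posDef_add.isUnit),
        Matrix.one_mulVec]
    rwa [Matrix.add_mulVec, Matrix.smul_mulVec, Matrix.one_mulVec] at mulVec_u
  have mulVec_sub : N *ᵥ (w - u) = ε • u := by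
    rw [Matrix.mulVec_sub, ← hNu, add_sub_cancel_left]
  have inner_nonneg : 0 ≤ RCLike.re (star u ⬝ᵥ (w - u)) := by
    have hform : 0 ≤ plusNormSq N (w - u) := plusNormSq_nonneg hN _
    rw [plusNormSq, mulVec_sub, dotProduct_smul, RCLike.smul_re, re_star_dotProduct_comm] at hform
    exact nonneg_of_mul_nonneg_right hform hε
  have expand := plusNormSq_add (M := (1 : Matrix (Fin n) (Fin n) 𝕜)) Matrix.isHermitian_one
    u (w - u)
  rw [add_sub_cancel, Matrix.one_mulVec] at expand
  linarith [plusNormSq_nonneg (M := (1 : Matrix (Fin n) (Fin n) 𝕜)) .one (w - u)]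

theorem exists_plusNormSq_resolvent_mulVec_le {N : Matrix (Fin n) (Fin n) 𝕜} (hN : N.PosSemidef)
    (P : Matrix (Fin n) (Fin n) 𝕜) (w : Fin n → 𝕜) :
    ∃ C, ∀ ε : ℝ, 0 < ε →
      plusNormSq P ((N + ε • (1 : Matrix (Fin n) (Fin n) 𝕜))⁻¹ *ᵥ (N *ᵥ w)) ≤ C := by
  obtain ⟨C, hC⟩ := (isCompact_plusBall (𝕜 := 𝕜) .one (plusNormSq 1 w)).bddAbove_image
    (continuous_plusNormSq P).continuousOn
  exact ⟨C, fun ε hε => hC ⟨_, plusNormSq_one_resolvent_mulVec_le hN hε w, rfl⟩⟩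

theorem isHermitian_combMat {A : Fin m → Matrix (Fin n) (Fin n) 𝕜} (hA : ∀ i, (A i).IsHermitian)
    (c : Fin m → ℝ) : (combMat c A).IsHermitian :=
  isSelfAdjoint_sum _ fun i _ => (hA i).smul (.all (c i))

theorem combVec_notMem_range_of_hasEpsMaxSq_top {A : Fin m → Matrix (Fin n) (Fin n) 𝕜}
    (hA : ∀ i, (A i).IsHermitian) {v : Fin m → Fin n → 𝕜} {x₀ : Fin n → 𝕜}
    {P : Matrix (Fin n) (Fin n) 𝕜} (hP : P.PosDef) (hmax : HasEpsMaxSq A v x₀ P ⊤)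
    {c : Fin m → ℝ} (hc : c ∈ admissible A P) :
    combVec c A v x₀ ∉ Set.range (combMat c A - lamMin P (combMat c A) • P).mulVec := by
  rintro ⟨w, hw⟩
  obtain ⟨C, hC⟩ := exists_plusNormSq_resolvent_mulVec_le
    (posSemidef_sub_lamMin_smul (isHermitian_combMat hA c) hP) P w
  have min_le : ∀ᶠ ε in 𝓝[>] (0 : ℝ), minResolventNormSq A v x₀ P ε ≤ ENNReal.ofReal C := by
    filter_upwards [self_mem_nhdsWithin] with ε hε
    refine (iInf₂_le c hc).trans (ENNReal.ofReal_le_ofReal ?_)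
    rw [resolventNormSq, ← hw]
    exact hC ε hε
  exact ENNReal.ofReal_ne_top (top_le_iff.1 (le_of_tendsto hmax min_le))

end Resolvent

section Image

variable {𝕜 : Type*} [RCLike 𝕜] {n m : ℕ} {A : Fin m → Matrix (Fin n) (Fin n) 𝕜}
  {P : Matrix (Fin n) (Fin n) 𝕜} {v : Fin m → Fin n → 𝕜} {x₀ : Fin n → 𝕜}

theorem continuous_quadMap (A : Fin m → Matrix (Fin n) (Fin n) 𝕜) (v : Fin m → Fin n → 𝕜)
    (f₀ : Fin m → ℝ) : Continuous (quadMap A v f₀) := by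
  unfold quadMap
  fun_prop

theorem quadMap_add_apply (hA : ∀ i, (A i).IsHermitian) (v : Fin m → Fin n → 𝕜) (f₀ : Fin m → ℝ)
    (x₀ y : Fin n → 𝕜) (i : Fin m) :
    quadMap A v f₀ (x₀ + y) i =
      quadObjective (A i) (v i - A i *ᵥ x₀) y + quadMap A v f₀ x₀ i := by
  simp only [quadMap, quadObjective, plusNormSq, star_add, Matrix.mulVec_add, add_dotProduct,
    dotProduct_add, dotProduct_sub, map_add, map_sub, re_star_dotProduct_mulVec_comm (hA i) x₀ y,
    re_star_dotProduct_comm (v i) y]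
  ring

theorem quadObjective_combMat_combVec (c : Fin m → ℝ) (A : Fin m → Matrix (Fin n) (Fin n) 𝕜)
    (v : Fin m → Fin n → 𝕜) (x₀ y : Fin n → 𝕜) :
    quadObjective (combMat c A) (combVec c A v x₀) y =
      ∑ i, c i * quadObjective (A i) (v i - A i *ᵥ x₀) y := by
  simp only [quadObjective, plusNormSq, combMat, combVec, Matrix.sum_mulVec, Matrix.smul_mulVec,
    dotProduct_sum, dotProduct_smul, map_sum, RCLike.smul_re, Finset.mul_sum,
    ← Finset.sum_sub_distrib]
  exact Finset.sum_congr rfl fun i _ => by ring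

theorem dotProduct_quadMap_add (hA : ∀ i, (A i).IsHermitian) (v : Fin m → Fin n → 𝕜)
    (f₀ : Fin m → ℝ) (x₀ y : Fin n → 𝕜) (c : Fin m → ℝ) :
    c ⬝ᵥ quadMap A v f₀ (x₀ + y) =
      quadObjective (combMat c A) (combVec c A v x₀) y + c ⬝ᵥ quadMap A v f₀ x₀ := by
  simp only [dotProduct, quadMap_add_apply hA, quadObjective_combMat_combVec, mul_add,
    Finset.sum_add_distrib]

theorem hasUniqueSupportPoints_image_quadMap (hA : ∀ i, (A i).IsHermitian) (f₀ : Fin m → ℝ)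
    (hP : P.PosDef) (hb : ∀ c ∈ admissible A P,
      combVec c A v x₀ ∉ Set.range (combMat c A - lamMin P (combMat c A) • P).mulVec) (ρ : ℝ) :
    HasUniqueSupportPoints
      ((fun y => WithLp.toLp 2 (quadMap A v f₀ (x₀ + y))) '' plusBall P ρ) := by
  intro c hc
  have inner_eq : ∀ y, inner ℝ c (WithLp.toLp 2 (quadMap A v f₀ (x₀ + y))) =
      quadObjective (combMat c.ofLp A) (combVec c.ofLp A v x₀) y + c.ofLp ⬝ᵥ quadMap A v f₀ x₀ :=
    fun y => by
      rw [← dotProduct_quadMap_add hA, EuclideanSpace.inner_eq_star_dotProduct, star_trivial,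
        dotProduct_comm]
  have c_unit : c.ofLp ⬝ᵥ c.ofLp = 1 := by
    simpa [hc, dotProduct, ← sq] using (EuclideanSpace.real_norm_sq_eq c).symm
  have isMinOn_objective : ∀ y, IsMinOn (inner ℝ c)
      ((fun y => WithLp.toLp 2 (quadMap A v f₀ (x₀ + y))) '' plusBall P ρ)
      (WithLp.toLp 2 (quadMap A v f₀ (x₀ + y))) →
      IsMinOn (quadObjective (combMat c.ofLp A) (combVec c.ofLp A v x₀)) (plusBall P ρ) y := by
    intro y hy z hz
    have hle := hy (Set.mem_image_of_mem _ hz)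
    simpa [inner_eq] using hle
  rintro _ ⟨⟨y₁, hy₁, rfl⟩, h₁⟩ _ ⟨⟨y₂, hy₂, rfl⟩, h₂⟩
  rw [eq_of_isMinOn_quadObjective (isHermitian_combMat hA _) hP
    (fun hlam => hb c.ofLp ⟨c_unit, hlam⟩) hy₁ hy₂ (isMinOn_objective y₁ h₁)
    (isMinOn_objective y₂ h₂)]

theorem convex_range_quadMap (hA : ∀ i, (A i).IsHermitian) (f₀ : Fin m → ℝ) (hP : P.PosDef)
    (hb : ∀ c ∈ admissible A P,
      combVec c A v x₀ ∉ Set.range (combMat c A - lamMin P (combMat c A) • P).mulVec) :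
    Convex ℝ (Set.range (quadMap A v f₀)) := by
  rintro _ ⟨x₁, rfl⟩ _ ⟨x₂, rfl⟩ s t hs ht hst
  set ρ := max (plusNormSq P (x₁ - x₀)) (plusNormSq P (x₂ - x₀))
  let F : ℝ → (Fin n → 𝕜) → EuclideanSpace ℝ (Fin m) := fun r y =>
    WithLp.toLp 2 (quadMap A v f₀ (x₀ + r • y))
  have F_continuous : Continuous ↿F :=
    (PiLp.continuous_toLp 2 _).comp ((continuous_quadMap A v f₀).comp (by fun_prop))
  have F_zero : (F 0 '' plusBall P ρ).Subsingleton := by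
    rintro _ ⟨y, -, rfl⟩ _ ⟨z, -, rfl⟩
    simp [F]
  have F_unique : ∀ r ≠ 0, HasUniqueSupportPoints (F r '' plusBall P ρ) := by
    intro r hr
    have h := hasUniqueSupportPoints_image_quadMap hA f₀ hP hb (r ^ 2 * ρ)
    rwa [← image_smul_plusBall P ρ hr, Set.image_image] at h
  have mem_image : ∀ x, plusNormSq P (x - x₀) ≤ ρ →
      WithLp.toLp 2 (quadMap A v f₀ x) ∈ F 1 '' plusBall P ρ :=
    fun x hx => ⟨x - x₀, hx, by simp [F]⟩
  have mem_hull : WithLp.toLp 2 (s • quadMap A v f₀ x₁ + t • quadMap A v f₀ x₂) ∈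
      convexHull ℝ (F 1 '' plusBall P ρ) :=
    convex_convexHull ℝ _ (subset_convexHull ℝ _ (mem_image x₁ (le_max_left _ _)))
      (subset_convexHull ℝ _ (mem_image x₂ (le_max_right _ _))) hs ht hst
  obtain ⟨r, y, -, hy⟩ := exists_mem_image_of_mem_convexHull (isCompact_plusBall hP ρ)
    F_continuous F_zero F_unique mem_hull
  exact ⟨x₀ + r • y, congrArg WithLp.ofLp hy⟩

end Image

end QuadImage

theorem proposition1 {𝕜 : Type*} [RCLike 𝕜] {n m : ℕ}
    (A : Fin m → Matrix (Fin n) (Fin n) 𝕜) (hA : ∀ i, (A i).IsHermitian)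
    (v : Fin m → Fin n → 𝕜) (f₀ : Fin m → ℝ)
    (hmax : ∃ (x₀ : Fin n → 𝕜) (Aplus : Matrix (Fin n) (Fin n) 𝕜),
      Aplus.PosDef ∧ QuadImage.HasEpsMaxSq A v x₀ Aplus ⊤) :
    Convex ℝ (Set.range (QuadImage.quadMap A v f₀)) := by
  obtain ⟨x₀, P, hP, hmax⟩ := hmax
  exact QuadImage.convex_range_quadMap hA f₀ hP fun c hc =>
    QuadImage.combVec_notMem_range_of_hasEpsMaxSq_top hA hP hmax hc
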